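/- Let $n\ge 4$. A unicyclic graph is a finite simple connected graph with as many edges as vertices (equivalently, a connected graph containing exactly one cycle); its girth is the length of its cycle. For a graph $G$ of order $n$ with adjacency matrix $A(G)$ and diagonal degree matrix $D(G)$, let $\nu_1(G)\ge\dots\ge\nu_n(G)\ge 0$ be the eigenvalues, counted with multiplicity, of the signless Laplacian matrix $Q(G)=D(G)+A(G)$. The incidence energy of $G$ is $IE(G)=\sum_{i=1}^n\sqrt{\nu_i(G)}$. Let $S_4'$ be the graph of order $n$ obtained from a cycle of length $4$ by attaching $n-4$ pendent vertices to one and the same vertex of the cycle. Then $S_4'$ is, up to isomorphism, the unique graph with minimal incidence energy among all unicyclic graphs of order $n$ with even girth: $S_4'$ is such a graph, and every unicyclic graph $G$ of order $n$ with even girth satisfies $IE(G)\ge IE(S_4')$, with equality if and only if $G\cong S_4'$. -/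

import Mathlib

namespace SimpleGraph

/-- A unicyclic graph: a finite connected graph with as many edges as vertices. -/
def IsUnicyclic {V : Type*} [Fintype V] (G : SimpleGraph V) : Prop :=
  G.Connected ∧ G.edgeSet.ncard = Fintype.card V

/-- The signless Laplacian matrix `Q(G) = D(G) + A(G)` with real entries. -/
def signlessLapMatrix {V : Type*} [Fintype V] [DecidableEq V] (G : SimpleGraph V)
    [DecidableRel G.Adj] : Matrix V V ℝ :=
  G.degMatrix ℝ + G.adjMatrix ℝ

theorem isHermitian_signlessLapMatrix {V : Type*} [Fintype V] [DecidableEq V]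
    (G : SimpleGraph V) [DecidableRel G.Adj] : G.signlessLapMatrix.IsHermitian := by
  ext i j
  by_cases h : i = j
  · subst h; simp
  · simp [signlessLapMatrix, degMatrix, h, Ne.symm h, adj_comm]

open Classical in
/-- The incidence energy `IE(G)`: the sum of the square roots of the eigenvalues of `Q(G)`,
counted with multiplicity. -/
noncomputable def incidenceEnergy {V : Type*} [Fintype V] (G : SimpleGraph V) : ℝ :=
  ∑ i, √(G.isHermitian_signlessLapMatrix.eigenvalues i)

/-- The graph `S₄'` of order `n ≥ 4`: a cycle of length four (the left summand) with `n - 4`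
pendent vertices (the right summand), all attached to the same vertex of the cycle. -/
def starC4 (n : ℕ) : SimpleGraph (Fin 4 ⊕ Fin (n - 4)) where
  Adj x y :=
    match x, y with
    | Sum.inl i, Sum.inl j => (cycleGraph 4).Adj i j
    | Sum.inl i, Sum.inr _ => i = 3
    | Sum.inr _, Sum.inl i => i = 3
    | Sum.inr _, Sum.inr _ => False
  symm := ⟨by
    rintro (i | i) (j | j) h
    · exact (cycleGraph 4).adj_symm h
    all_goals exact h⟩
  loopless := ⟨by
    rintro (i | i) h
    · exact (cycleGraph 4).loopless.irrefl i h
    · exact h⟩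

end SimpleGraph

/-!
Put `L(G) = D(G) - A(G)` and `d_G(x) = det (1 + x L(G))`. For bipartite `G` the matrices `Q(G)` and
`L(G)` are conjugate by a diagonal sign matrix, and `∫₀^∞ log (1 + a / s²) ds = π √a`, so
`π IE(G) = ∫₀^∞ log d_G(s⁻²) ds`. A unicyclic graph of even girth is bipartite, hence it suffices to
show `d_G(x) > d_{S₄'}(x)` for every `x > 0` when `G` is not `S₄'`. This goes by induction on `n`,
together with the bound of the principal minors of `1 + x L(G)` by the minor at the centre of `S₄'`:
the determinant and the minors of `G` are expressed through those of a smaller graph, obtained by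
deleting a leaf or, when `G` is a cycle, by suppressing a vertex. The extremal case is recognised by
a vertex of degree `n - 2`, whose neighbourhood is independent because `G` has no triangle.
-/

section LogIntegral

open Filter MeasureTheory Set Topology

/-- A primitive of `s ↦ log (1 + b ^ 2 / s ^ 2)` on `(0, ∞)`, written with `s * log s` so that it
is continuous at `0`. -/
noncomputable def logPrimitive (b s : ℝ) : ℝ :=
  s * Real.log (b ^ 2 + s ^ 2) - 2 * (s * Real.log s) + 2 * b * Real.arctan (s / b)

theorem log_one_add_sq_div_sq {b s : ℝ} (hb : b ≠ 0) (hs : s ≠ 0) :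
    Real.log (1 + b ^ 2 / s ^ 2) = Real.log (b ^ 2 + s ^ 2) - 2 * Real.log s := by
  have hsplit : 1 + b ^ 2 / s ^ 2 = (b ^ 2 + s ^ 2) / s ^ 2 := by field_simp; ring
  rw [hsplit, Real.log_div (by positivity) (by positivity), Real.log_pow, Nat.cast_ofNat]

theorem continuous_logPrimitive {b : ℝ} (hb : b ≠ 0) : Continuous (logPrimitive b) := by
  have hlog : Continuous fun s : ℝ => Real.log (b ^ 2 + s ^ 2) :=
    Continuous.log (by fun_prop) fun s => by positivity
  have harctan : Continuous fun s : ℝ => Real.arctan (s / b) :=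
    Real.continuous_arctan.comp (by fun_prop)
  exact ((continuous_id.mul hlog).sub (continuous_const.mul Real.continuous_mul_log)).add
    (continuous_const.mul harctan)

theorem hasDerivAt_logPrimitive {b s : ℝ} (hb : b ≠ 0) (hs : s ≠ 0) :
    HasDerivAt (logPrimitive b) (Real.log (1 + b ^ 2 / s ^ 2)) s := by
  have hpos : 0 < b ^ 2 + s ^ 2 := by positivity
  have hlog : HasDerivAt (fun s => Real.log (b ^ 2 + s ^ 2)) (2 * s / (b ^ 2 + s ^ 2)) s := by
    simpa using ((hasDerivAt_pow 2 s).const_add (b ^ 2)).log hpos.ne'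
  have harctan : HasDerivAt (fun s => Real.arctan (s / b)) (1 / (1 + (s / b) ^ 2) * (1 / b)) s :=
    ((hasDerivAt_id' s).div_const b).arctan
  refine ((((hasDerivAt_id' s).mul hlog).sub
    ((Real.hasDerivAt_mul_log hs).const_mul 2)).add (harctan.const_mul (2 * b))).congr_deriv ?_
  rw [log_one_add_sq_div_sq hb hs]
  field_simp
  ring

theorem tendsto_mul_log_one_add_sq_div_sq (b : ℝ) :
    Tendsto (fun s => s * Real.log (1 + b ^ 2 / s ^ 2)) atTop (𝓝 0) := by
  refine squeeze_zero' ?_ ?_ ((tendsto_const_nhds (x := b ^ 2)).div_atTop tendsto_id)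
  all_goals filter_upwards [eventually_gt_atTop 0] with s hs
  · have : 0 ≤ b ^ 2 / s ^ 2 := by positivity
    exact mul_nonneg hs.le (Real.log_nonneg (by linarith))
  · calc s * Real.log (1 + b ^ 2 / s ^ 2) ≤ s * (b ^ 2 / s ^ 2) := by
          gcongr
          linarith [Real.log_le_sub_one_of_pos (show 0 < 1 + b ^ 2 / s ^ 2 by positivity)]
      _ = b ^ 2 / s := by field_simp

theorem tendsto_logPrimitive {b : ℝ} (hb : 0 < b) :
    Tendsto (logPrimitive b) atTop (𝓝 (Real.pi * b)) := by
  have harctan : Tendsto (fun s => 2 * b * Real.arctan (s / b)) atTop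
      (𝓝 (2 * b * (Real.pi / 2))) :=
    ((tendsto_nhds_of_tendsto_nhdsWithin Real.tendsto_arctan_atTop).comp
      (tendsto_id.atTop_div_const hb)).const_mul (2 * b)
  rw [show Real.pi * b = 0 + 2 * b * (Real.pi / 2) by ring]
  refine ((tendsto_mul_log_one_add_sq_div_sq b).add harctan).congr' ?_
  filter_upwards [eventually_gt_atTop 0] with s hs
  rw [log_one_add_sq_div_sq hb.ne' hs.ne', logPrimitive]
  ring

theorem log_one_add_div_sq_nonneg {a : ℝ} (ha : 0 ≤ a) (s : ℝ) :
    0 ≤ Real.log (1 + a / s ^ 2) :=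
  Real.log_nonneg (le_add_of_nonneg_right (by positivity))

theorem integrableOn_log_one_add_div_sq {a : ℝ} (ha : 0 ≤ a) :
    IntegrableOn (fun s => Real.log (1 + a / s ^ 2)) (Ioi 0) := by
  obtain rfl | hpos := ha.eq_or_lt
  · simp
  have hb : 0 < √a := Real.sqrt_pos.2 hpos
  refine integrableOn_Ioi_deriv_of_nonneg (continuous_logPrimitive hb.ne').continuousWithinAt
    (fun s hs => ?_) (fun s _ => log_one_add_div_sq_nonneg ha s) (tendsto_logPrimitive hb)
  simpa only [Real.sq_sqrt ha] using hasDerivAt_logPrimitive hb.ne' (ne_of_gt hs)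

theorem integral_log_one_add_div_sq {a : ℝ} (ha : 0 ≤ a) :
    ∫ s in Ioi (0 : ℝ), Real.log (1 + a / s ^ 2) = Real.pi * √a := by
  obtain rfl | hpos := ha.eq_or_lt
  · simp
  have hb : 0 < √a := Real.sqrt_pos.2 hpos
  rw [integral_Ioi_of_hasDerivAt_of_nonneg (continuous_logPrimitive hb.ne').continuousWithinAt
    (fun s hs => ?_) (fun s _ => log_one_add_div_sq_nonneg ha s) (tendsto_logPrimitive hb)]
  · simp [logPrimitive]
  · simpa only [Real.sq_sqrt ha] using hasDerivAt_logPrimitive hb.ne' (ne_of_gt hs)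

theorem setIntegral_lt_setIntegral_of_forall_lt {α : Type*} [MeasurableSpace α] {μ : Measure α}
    {s : Set α} {f g : α → ℝ} (hs : MeasurableSet s) (hμ : 0 < μ s) (hf : IntegrableOn f s μ)
    (hg : IntegrableOn g s μ) (h : ∀ x ∈ s, f x < g x) :
    ∫ x in s, f x ∂μ < ∫ x in s, g x ∂μ := by
  have hpos : ∀ x ∈ s, 0 < (g - f) x := fun x hx => sub_pos.2 (h x hx)
  rw [← sub_pos, ← integral_sub hg hf]
  refine (setIntegral_pos_iff_support_of_nonneg_ae ?_ (hg.sub hf)).2 (hμ.trans_le ?_)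
  · exact (ae_restrict_iff' hs).2 (.of_forall fun x hx => (hpos x hx).le)
  · exact measure_mono fun x hx => ⟨(hpos x hx).ne', hx⟩

end LogIntegral

section Determinants

open MeasureTheory Matrix
open Set (Ioi)

variable {ι : Type*} [Fintype ι] [DecidableEq ι]

theorem det_one_add_smul_eq_prod_eigenvalues {𝕜 : Type*} [RCLike 𝕜] {A : Matrix ι ι 𝕜}
    (hA : A.IsHermitian) (x : 𝕜) :
    (1 + x • A).det = ∏ i, (1 + x * (hA.eigenvalues i : 𝕜)) := by
  obtain rfl | hx := eq_or_ne x 0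
  · simp
  have hfactor : 1 + x • A = (-x) • (scalar ι (-x⁻¹) - A) := by
    ext i j
    by_cases hij : i = j
    · subst hij; simp [mul_sub, hx]
    · simp [hij]
  rw [hfactor, det_smul, ← eval_charpoly, hA.charpoly_eq, Polynomial.eval_prod,
    ← Finset.card_univ, ← Finset.prod_const, ← Finset.prod_mul_distrib]
  refine Finset.prod_congr rfl fun i _ => ?_
  simp [mul_sub, hx]

theorem log_det_one_add_inv_sq_smul {A : Matrix ι ι ℝ} (hA : A.PosSemidef) (s : ℝ) :
    Real.log (1 + (s ^ 2)⁻¹ • A).det =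
      ∑ i, Real.log (1 + hA.isHermitian.eigenvalues i / s ^ 2) := by
  rw [det_one_add_smul_eq_prod_eigenvalues hA.isHermitian, Real.log_prod]
  · simp only [RCLike.ofReal_real_eq_id, id_eq, div_eq_inv_mul]
  · intro i _
    have := hA.eigenvalues_nonneg i
    simp only [RCLike.ofReal_real_eq_id, id_eq]
    positivity

theorem integrableOn_log_det_one_add_inv_sq_smul {A : Matrix ι ι ℝ} (hA : A.PosSemidef) :
    IntegrableOn (fun s : ℝ => Real.log (1 + (s ^ 2)⁻¹ • A).det) (Ioi 0) := by
  simp only [log_det_one_add_inv_sq_smul hA]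
  exact integrable_finsetSum _ fun i _ =>
    integrableOn_log_one_add_div_sq (hA.eigenvalues_nonneg i)

theorem integral_log_det_one_add_inv_sq_smul {A : Matrix ι ι ℝ} (hA : A.PosSemidef) :
    ∫ s in Ioi (0 : ℝ), Real.log (1 + (s ^ 2)⁻¹ • A).det =
      Real.pi * ∑ i, √(hA.isHermitian.eigenvalues i) := by
  simp only [log_det_one_add_inv_sq_smul hA]
  rw [integral_finsetSum _ fun i _ => integrableOn_log_one_add_div_sq (hA.eigenvalues_nonneg i),
    Finset.mul_sum]
  exact Finset.sum_congr rfl fun i _ => integral_log_one_add_div_sq (hA.eigenvalues_nonneg i)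

theorem det_eq_mul_det_schur {K : Type*} [Field K] (M : Matrix ι ι K) {v : ι} (hv : M v v ≠ 0) :
    M.det = M v v * det (of fun i j : {y // y ≠ v} => M i j - M i v * M v j / M v v) := by
  let A : Matrix {y // y = v} {y // y = v} K := diagonal fun _ => M v v
  let B : Matrix {y // y = v} {y // y ≠ v} K := of fun _ j => M v j
  let C : Matrix {y // y ≠ v} {y // y = v} K := of fun i _ => M i v
  let D : Matrix {y // y ≠ v} {y // y ≠ v} K := of fun i j => M i j
  have hblocks : M.submatrix (Equiv.sumCompl (· = v)) (Equiv.sumCompl (· = v)) =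
      fromBlocks A B C D := by
    ext (⟨i, rfl⟩ | ⟨i, hi⟩) (⟨j, hj⟩ | ⟨j, hj⟩)
    · subst hj; simp [A]
    all_goals simp [B, C, D, hj]
  let _ : Invertible A :=
    { invOf := diagonal fun _ => (M v v)⁻¹
      invOf_mul_self := by simp [A, hv]
      mul_invOf_self := by simp [A, hv] }
  have hinv : ⅟A = diagonal fun _ => (M v v)⁻¹ := rfl
  rw [← det_submatrix_equiv_self (Equiv.sumCompl (· = v)), hblocks, det_fromBlocks₁₁, hinv]
  congr 1
  · simp [A]
  · congr 1
    ext i j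
    simp [B, C, D, mul_apply, div_eq_mul_inv, mul_right_comm]

end Determinants

section PairMatrix

open Matrix

variable {R ι : Type*} [CommRing R] [Fintype ι] [DecidableEq ι]

theorem det_add_single (M : Matrix ι ι R) (i j : ι) (r : R) :
    (M + single i j r).det = M.det + r * M.adjugate j i := by
  have hrow : M + single i j r = M.updateRow i (M i + r • Pi.single j 1) := by
    ext k l
    obtain rfl | hk := eq_or_ne k i
    · obtain rfl | hl := eq_or_ne l j
      · simp
      · simp [hl, hl.symm]
    · simp [hk, hk.symm]
  rw [hrow, det_updateRow_add, det_updateRow_smul, updateRow_eq_self, adjugate_apply]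

/-- The symmetric matrix with diagonal entries `p`, `q` and off-diagonal entry `r` on the rows and
columns `a`, `b`, and zeros elsewhere; the entries add up when `a = b`. -/
def pairMatrix (a b : ι) (p q r : R) : Matrix ι ι R :=
  single a a p + single b b q + (single a b r + single b a r)

theorem det_add_pairMatrix {K : Matrix ι ι R} (hK : IsUnit K.det) (hsymm : K.IsSymm) (a b : ι)
    (p q r : R) :
    (K + pairMatrix a b p q r).det = K.det * (1 + p * K⁻¹ a a + q * K⁻¹ b b + 2 * r * K⁻¹ a b +
      (p * q - r ^ 2) * (K⁻¹ a a * K⁻¹ b b - K⁻¹ a b ^ 2)) := by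
  let U : Matrix ι (Fin 2) R := single a 0 1 + single b 1 1
  let W : Matrix (Fin 2) ι R := single 0 a p + single 0 b r + single 1 a r + single 1 b q
  have hUW : pairMatrix a b p q r = U * W := by
    simp [U, W, pairMatrix, Matrix.add_mul, Matrix.mul_add, single_mul_single_of_ne]
    abel
  have hab : K⁻¹ b a = K⁻¹ a b := hsymm.inv.apply a b
  rw [hUW, det_add_mul U W hK, det_fin_two]
  simp [U, W, Matrix.add_mul, Matrix.mul_add, hab]
  ring

theorem inv_mul_inv_sub_sq_pos {K : Matrix ι ι ℝ} (hK : K.PosDef) {a b : ι} (hab : a ≠ b) :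
    0 < K⁻¹ a a * K⁻¹ b b - K⁻¹ a b ^ 2 := by
  have hinj : Function.Injective ![a, b] := by
    intro i j
    fin_cases i <;> fin_cases j <;> simp [hab, hab.symm]
  have hdet := (hK.inv.submatrix hinj).det_pos
  have hsymm : K⁻¹ b a = K⁻¹ a b := hK.inv.isHermitian.apply a b
  rw [det_fin_two] at hdet
  simpa [hsymm, sq] using hdet

end PairMatrix

section ShiftedLap

open Matrix SimpleGraph

variable {V : Type*} [Fintype V] [DecidableEq V]

/-- The matrix `1 + x L(G)`, where `L(G) = D(G) - A(G)` is the Laplacian; it is positive definite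
for `x > 0`. -/
noncomputable def shiftedLap (G : SimpleGraph V) [DecidableRel G.Adj] (x : ℝ) : Matrix V V ℝ :=
  1 + x • G.lapMatrix ℝ

/-- The determinant of `1 + x L(G)`. -/
noncomputable def lapDet (G : SimpleGraph V) [DecidableRel G.Adj] (x : ℝ) : ℝ :=
  (shiftedLap G x).det

/-- The principal minor of `1 + x L(G)` obtained by deleting the row and the column of `u`, encoded
as a diagonal entry of the adjugate. -/
noncomputable def lapMinor (G : SimpleGraph V) [DecidableRel G.Adj] (x : ℝ) (u : V) : ℝ :=
  (shiftedLap G x).adjugate u u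

variable (G : SimpleGraph V) [DecidableRel G.Adj] {x : ℝ}

theorem shiftedLap_apply_self (x : ℝ) (i : V) : shiftedLap G x i i = 1 + x * G.degree i := by
  simp [shiftedLap, lapMatrix, degMatrix]

theorem shiftedLap_apply_of_ne (x : ℝ) {i j : V} (h : i ≠ j) :
    shiftedLap G x i j = -(x * G.adjMatrix ℝ i j) := by
  simp [shiftedLap, lapMatrix, degMatrix, h]

theorem det_shiftedLap_add_diagonal_single (x : ℝ) (u : V) (r : ℝ) :
    (shiftedLap G x + diagonal (Pi.single u r)).det = lapDet G x + r * lapMinor G x u := by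
  rw [diagonal_single, det_add_single, lapDet, lapMinor]

theorem posDef_shiftedLap (hx : 0 ≤ x) : (shiftedLap G x).PosDef :=
  PosDef.one.add_posSemidef ((posSemidef_lapMatrix ℝ G).smul hx)

theorem isSymm_shiftedLap (x : ℝ) : (shiftedLap G x).IsSymm :=
  isSymm_one.add ((isSymm_lapMatrix ℝ G).smul x)

theorem lapDet_pos (hx : 0 ≤ x) : 0 < lapDet G x := (posDef_shiftedLap G hx).det_pos

theorem isUnit_det_shiftedLap (hx : 0 ≤ x) : IsUnit (shiftedLap G x).det :=
  (lapDet_pos G hx).ne'.isUnit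

theorem lapMinor_eq_lapDet_mul_inv (hx : 0 ≤ x) (u : V) :
    lapMinor G x u = lapDet G x * (shiftedLap G x)⁻¹ u u := by
  rw [inv_def, Matrix.smul_apply, smul_eq_mul, ← mul_assoc, lapDet,
    Ring.mul_inverse_cancel _ (isUnit_det_shiftedLap G hx), one_mul, lapMinor]

theorem shiftedLap_mulVec (x : ℝ) (z : V → ℝ) (i : V) :
    (shiftedLap G x *ᵥ z) i = z i + x * ∑ j ∈ G.neighborFinset i, (z i - z j) := by
  rw [shiftedLap, add_mulVec, one_mulVec, smul_mulVec, Pi.add_apply, Pi.smul_apply,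
    lapMatrix_mulVec_apply]
  simp [Finset.sum_sub_distrib]

theorem inv_shiftedLap_add_sum (hx : 0 ≤ x) (i a : V) :
    (shiftedLap G x)⁻¹ i a +
      x * ∑ j ∈ G.neighborFinset i, ((shiftedLap G x)⁻¹ i a - (shiftedLap G x)⁻¹ j a) =
      (1 : Matrix V V ℝ) i a := by
  rw [← mul_nonsing_inv _ (isUnit_det_shiftedLap G hx)]
  exact (shiftedLap_mulVec G x (fun k => (shiftedLap G x)⁻¹ k a) i).symm

theorem inv_shiftedLap_nonneg (hx : 0 ≤ x) (i a : V) : 0 ≤ (shiftedLap G x)⁻¹ i a := by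
  obtain ⟨k, -, hk⟩ := Finset.exists_min_image Finset.univ (fun k => (shiftedLap G x)⁻¹ k a)
    ⟨i, Finset.mem_univ i⟩
  have hsum : x * ∑ j ∈ G.neighborFinset k,
      ((shiftedLap G x)⁻¹ k a - (shiftedLap G x)⁻¹ j a) ≤ 0 :=
    mul_nonpos_of_nonneg_of_nonpos hx
      (Finset.sum_nonpos fun j _ => sub_nonpos.2 (hk j (Finset.mem_univ j)))
  have hone : 0 ≤ (1 : Matrix V V ℝ) k a := by rw [one_apply]; positivity
  linarith [inv_shiftedLap_add_sum G hx k a, hk i (Finset.mem_univ i)]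

theorem inv_shiftedLap_pos_of_adj (hx : 0 < x) {j a : V} (h : G.Adj j a) :
    0 < (shiftedLap G x)⁻¹ j a := by
  have hdiag : 0 < (shiftedLap G x)⁻¹ a a := (posDef_shiftedLap G hx.le).inv.diag_pos
  have hle : (shiftedLap G x)⁻¹ a a ≤ ∑ k ∈ G.neighborFinset j, (shiftedLap G x)⁻¹ k a :=
    Finset.single_le_sum (fun k _ => inv_shiftedLap_nonneg G hx.le k a)
      ((G.mem_neighborFinset j a).2 h)
  have hentry := inv_shiftedLap_add_sum G hx.le j a
  rw [Finset.sum_sub_distrib, Finset.sum_const, nsmul_eq_mul, one_apply_ne h.ne] at hentry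
  have hprod : 0 < (1 + x * (G.neighborFinset j).card) * (shiftedLap G x)⁻¹ j a := by
    linarith [mul_pos hx (hdiag.trans_le hle)]
  exact pos_of_mul_pos_right hprod (by positivity)

theorem sum_inv_shiftedLap (hx : 0 ≤ x) (i : V) : ∑ j, (shiftedLap G x)⁻¹ i j = 1 := by
  have hfix : shiftedLap G x *ᵥ 1 = 1 := by ext i; simp [shiftedLap_mulVec]
  have hinv : (shiftedLap G x)⁻¹ *ᵥ 1 = 1 := by
    conv_lhs => rw [← hfix, mulVec_mulVec, nonsing_inv_mul _ (isUnit_det_shiftedLap G hx),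
      one_mulVec]
  simpa [mulVec, dotProduct] using congrFun hinv i

theorem inv_shiftedLap_self_lt_one (hx : 0 < x) {a : V} (ha : 0 < G.degree a) :
    (shiftedLap G x)⁻¹ a a < 1 := by
  obtain ⟨j, hj⟩ := (G.degree_pos_iff_exists_adj a).1 ha
  rw [← sum_inv_shiftedLap G hx.le a]
  exact Finset.single_lt_sum hj.ne' (Finset.mem_univ a) (Finset.mem_univ j)
    (inv_shiftedLap_pos_of_adj G hx hj) fun k _ _ => inv_shiftedLap_nonneg G hx.le a k

theorem lapMinor_pos (hx : 0 ≤ x) (u : V) : 0 < lapMinor G x u := by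
  rw [lapMinor_eq_lapDet_mul_inv G hx]
  exact mul_pos (lapDet_pos G hx) (posDef_shiftedLap G hx).inv.diag_pos

theorem lapMinor_lt_lapDet (hx : 0 < x) {u : V} (hu : 0 < G.degree u) :
    lapMinor G x u < lapDet G x := by
  rw [lapMinor_eq_lapDet_mul_inv G hx.le]
  exact mul_lt_of_lt_one_right (lapDet_pos G hx.le) (inv_shiftedLap_self_lt_one G hx hu)

end ShiftedLap

section VertexElimination

open Matrix SimpleGraph

/-- The graph obtained from `G` by deleting the vertex `v`. -/
abbrev deleteVert {V : Type*} (G : SimpleGraph V) (v : V) : SimpleGraph {y // y ≠ v} :=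
  G.comap Subtype.val

/-- The indicator vector of the neighbours of `v`, on the vertices other than `v`. -/
def neighborIndicator {V : Type*} (G : SimpleGraph V) [DecidableRel G.Adj] (v : V) :
    {y // y ≠ v} → ℝ :=
  fun y => G.adjMatrix ℝ v y

variable {V : Type*} [Fintype V] [DecidableEq V]

theorem degree_deleteVert_add (G : SimpleGraph V) [DecidableRel G.Adj] (v : V)
    (y : {y // y ≠ v}) :
    (deleteVert G v).degree y + (if G.Adj v y then 1 else 0) = G.degree y := by
  have hdel := degree_eq_sum_if_adj (deleteVert G v) (R := ℕ) y
  have hdeg := degree_eq_sum_if_adj G (R := ℕ) (y : V)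
  rw [Fintype.sum_eq_add_sum_subtype_ne _ v] at hdeg
  simp only [Nat.cast_id, comap_adj] at hdel hdeg
  simp only [hdeg, hdel, G.adj_comm v, add_comm]

theorem det_shiftedLap_add_diagonal (G : SimpleGraph V) [DecidableRel G.Adj] {x : ℝ} (v : V)
    {d : V → ℝ} (hd : 1 + x * G.degree v + d v ≠ 0) :
    (shiftedLap G x + diagonal d).det = (1 + x * G.degree v + d v) *
      (shiftedLap (deleteVert G v) x +
        (diagonal (fun y : {y // y ≠ v} => d y + x * neighborIndicator G v y) -
          (x ^ 2 / (1 + x * G.degree v + d v)) •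
            vecMulVec (neighborIndicator G v) (neighborIndicator G v))).det := by
  have hvv : (shiftedLap G x + diagonal d) v v = 1 + x * G.degree v + d v := by
    simp [shiftedLap_apply_self]
  have hrow (y : {y // y ≠ v}) :
      (shiftedLap G x + diagonal d) v y = -(x * neighborIndicator G v y) := by
    simp [shiftedLap_apply_of_ne, y.2.symm, neighborIndicator]
  have hcol (y : {y // y ≠ v}) :
      (shiftedLap G x + diagonal d) y v = -(x * neighborIndicator G v y) := by
    simp [shiftedLap_apply_of_ne, y.2, neighborIndicator, adj_comm]
  rw [det_eq_mul_det_schur _ (hvv ▸ hd), hvv]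
  congr 2
  ext i j
  rw [of_apply, hrow, hcol]
  obtain rfl | hij := eq_or_ne i j
  · have hdeg : ((deleteVert G v).degree i : ℝ) + neighborIndicator G v i = G.degree i := by
      simp [← degree_deleteVert_add G v i, neighborIndicator, adjMatrix_apply]
    simp only [Matrix.add_apply, shiftedLap_apply_self, diagonal_apply_eq, Matrix.sub_apply,
      Matrix.smul_apply, vecMulVec_apply, smul_eq_mul, ← hdeg]
    ring
  · have hij' : (i : V) ≠ j := Subtype.coe_ne_coe.2 hij
    simp only [Matrix.add_apply, shiftedLap_apply_of_ne _ _ hij, shiftedLap_apply_of_ne _ _ hij',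
      diagonal_apply_ne _ hij, diagonal_apply_ne _ hij', Matrix.sub_apply, Matrix.smul_apply,
      vecMulVec_apply, smul_eq_mul, adjMatrix_apply, comap_adj]
    ring

section Leaf

variable {G : SimpleGraph V} [DecidableRel G.Adj] {x : ℝ} {v : V} {w : {y // y ≠ v}}
  (hw : G.neighborFinset v = {↑w})
include hw

theorem neighborIndicator_of_leaf : neighborIndicator G v = Pi.single w 1 := by
  ext y
  simp [neighborIndicator, Pi.single_apply, ← mem_neighborFinset, hw, Subtype.coe_inj]

theorem det_shiftedLap_add_diagonal_leaf {d : V → ℝ} (hd : 1 + x + d v ≠ 0) :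
    (shiftedLap G x + diagonal d).det = (1 + x + d v) *
      (shiftedLap (deleteVert G v) x + (diagonal (fun y : {y // y ≠ v} => d y) +
        single w w (x - x ^ 2 / (1 + x + d v)))).det := by
  have hdeg : G.degree v = 1 := by rw [← card_neighborFinset_eq_degree, hw, Finset.card_singleton]
  rw [det_shiftedLap_add_diagonal G v (by simpa [hdeg] using hd), neighborIndicator_of_leaf hw,
    ← single_eq_single_vecMulVec_single, hdeg, smul_single, Nat.cast_one, mul_one]
  congr 3
  rw [← diagonal_single, ← diagonal_single, diagonal_sub, diagonal_add]
  congr 1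
  ext y
  obtain rfl | hy := eq_or_ne y w <;> simp [*]
  ring

theorem lapDet_add_mul_lapMinor_leaf (hx : 0 ≤ x) {r : ℝ} (hr : 0 ≤ r) :
    lapDet G x + r * lapMinor G x v =
      (1 + x + r) * lapDet (deleteVert G v) x +
        x * (1 + r) * lapMinor (deleteVert G v) x w := by
  have hpos : 1 + x + r ≠ 0 := by positivity
  have hzero : (fun y : {y // y ≠ v} => (Pi.single v r : V → ℝ) y) = 0 := by
    ext y; simp [y.2]
  rw [← det_shiftedLap_add_diagonal_single,
    det_shiftedLap_add_diagonal_leaf hw (by simpa using hpos), hzero, Pi.single_eq_same,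
    diagonal_zero', zero_add, det_add_single, ← lapDet, ← lapMinor]
  field_simp
  ring

theorem lapDet_leaf (hx : 0 ≤ x) :
    lapDet G x =
      (1 + x) * lapDet (deleteVert G v) x + x * lapMinor (deleteVert G v) x w := by
  simpa using lapDet_add_mul_lapMinor_leaf hw hx le_rfl

theorem lapMinor_leaf_self (hx : 0 ≤ x) :
    lapMinor G x v = lapDet (deleteVert G v) x + x * lapMinor (deleteVert G v) x w := by
  linarith [lapDet_add_mul_lapMinor_leaf hw hx zero_le_one, lapDet_leaf hw hx]

theorem lapMinor_leaf (hx : 0 ≤ x) (u : {y // y ≠ v}) :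
    lapMinor G x u = (1 + x) * lapMinor (deleteVert G v) x u +
      x * (lapDet (deleteVert G v) x * ((shiftedLap (deleteVert G v) x)⁻¹ w w *
        (shiftedLap (deleteVert G v) x)⁻¹ u u - (shiftedLap (deleteVert G v) x)⁻¹ w u ^ 2)) := by
  have hpos : 1 + x ≠ 0 := by positivity
  have hpert : diagonal (fun y : {y // y ≠ v} => (Pi.single (u : V) 1 : V → ℝ) y) +
      single w w (x - x ^ 2 / (1 + x)) = pairMatrix w u (x / (1 + x)) 1 0 := by
    have hsingle : (fun y : {y // y ≠ v} => (Pi.single (u : V) 1 : V → ℝ) y) = Pi.single u 1 := by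
      ext y; simp [Pi.single_apply, Subtype.coe_inj]
    have hcoeff : x - x ^ 2 / (1 + x) = x / (1 + x) := by field_simp; ring
    rw [hsingle, hcoeff, diagonal_single, pairMatrix]
    simp [add_comm]
  have hdet : lapDet G x + 1 * lapMinor G x u = (1 + x) *
      (shiftedLap (deleteVert G v) x + pairMatrix w u (x / (1 + x)) 1 0).det := by
    rw [← det_shiftedLap_add_diagonal_single,
      det_shiftedLap_add_diagonal_leaf hw (by simpa [u.2.symm] using hpos)]
    simp only [Pi.single_eq_of_ne u.2.symm, add_zero, hpert]
  rw [det_add_pairMatrix (isUnit_det_shiftedLap _ hx) (isSymm_shiftedLap _ x), ← lapDet,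
    lapDet_leaf hw hx, lapMinor_eq_lapDet_mul_inv _ hx w] at hdet
  rw [lapMinor_eq_lapDet_mul_inv _ hx u]
  field_simp at hdet
  linear_combination hdet

theorem lapMinor_leaf_neighbor (hx : 0 ≤ x) :
    lapMinor G x w = (1 + x) * lapMinor (deleteVert G v) x w := by
  rw [lapMinor_leaf hw hx]
  ring

theorem mul_lapMinor_lt_lapMinor_leaf (hx : 0 < x) {u : {y // y ≠ v}} (hu : u ≠ w) :
    (1 + x) * lapMinor (deleteVert G v) x u < lapMinor G x u := by
  rw [lapMinor_leaf hw hx.le]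
  exact lt_add_of_pos_right _ (mul_pos hx (mul_pos (lapDet_pos _ hx.le)
    (inv_mul_inv_sub_sq_pos (posDef_shiftedLap _ hx.le) hu.symm)))

end Leaf

end VertexElimination

section Suppression

open Matrix SimpleGraph

/-- The graph obtained from `G` by deleting `v` and joining `a` to `b`: suppression of `v` when `a`
and `b` are its only neighbours. -/
abbrev suppress {V : Type*} (G : SimpleGraph V) (v : V) (a b : {y // y ≠ v}) :
    SimpleGraph {y // y ≠ v} :=
  deleteVert G v ⊔ edge a b

variable {V : Type*} [Fintype V] [DecidableEq V]

omit [Fintype V] in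
theorem adjMatrix_sup_edge {G : SimpleGraph V} [DecidableRel G.Adj] {a b : V} (hab : a ≠ b)
    (hnadj : ¬G.Adj a b) :
    (G ⊔ edge a b).adjMatrix ℝ = G.adjMatrix ℝ + (single a b 1 + single b a 1) := by
  have hnadj' : ¬G.Adj b a := fun h => hnadj h.symm
  ext i j
  simp only [adjMatrix_apply, sup_adj, edge_adj, Matrix.add_apply, single_apply]
  grind

theorem lapMatrix_eq_diagonal_mulVec_sub (G : SimpleGraph V) [DecidableRel G.Adj] :
    G.lapMatrix ℝ = diagonal (G.adjMatrix ℝ *ᵥ 1) - G.adjMatrix ℝ := by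
  rw [lapMatrix, degMatrix]
  congr
  ext i
  simp [adjMatrix_mulVec_apply]

theorem shiftedLap_sup_edge {G : SimpleGraph V} [DecidableRel G.Adj] (x : ℝ) {a b : V}
    (hab : a ≠ b) (hnadj : ¬G.Adj a b) :
    shiftedLap (G ⊔ edge a b) x = shiftedLap G x + pairMatrix a b x x (-x) := by
  have hrows : (single a b 1 + single b a 1 : Matrix V V ℝ) *ᵥ 1 =
      Pi.single a 1 + Pi.single b 1 := by
    rw [add_mulVec]
    simp [single_mulVec, Pi.single]
  have hlap : (G ⊔ edge a b).lapMatrix ℝ = G.lapMatrix ℝ + pairMatrix a b 1 1 (-1) := by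
    rw [lapMatrix_eq_diagonal_mulVec_sub, lapMatrix_eq_diagonal_mulVec_sub,
      adjMatrix_sup_edge hab hnadj, add_mulVec, hrows, pairMatrix, ← diagonal_single,
      ← diagonal_single, diagonal_add]
    simp only [Pi.add_def, ← diagonal_add, ← single_neg]
    abel
  rw [shiftedLap, shiftedLap, hlap, smul_add, add_assoc, pairMatrix, pairMatrix]
  simp only [smul_add, smul_single, smul_eq_mul, mul_one, mul_neg]

variable {G : SimpleGraph V} [DecidableRel G.Adj] {x : ℝ} {v : V} {a b : {y // y ≠ v}}

theorem lapDet_suppress_add_mul_lapMinor (hab : a ≠ b) (hnadj : ¬G.Adj a b) (r : ℝ) :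
    lapDet (suppress G v a b) x + r * lapMinor (suppress G v a b) x a =
      (shiftedLap (deleteVert G v) x + pairMatrix a b (x + r) x (-x)).det := by
  rw [← det_shiftedLap_add_diagonal_single, shiftedLap_sup_edge x hab hnadj, diagonal_single,
    add_assoc, pairMatrix, pairMatrix, single_add]
  congr 2
  abel

theorem lapDet_add_mul_lapMinor_of_degree_two (hab : a ≠ b)
    (hv : G.neighborFinset v = {↑a, ↑b}) (hx : 0 ≤ x) (r : ℝ) :
    lapDet G x + r * lapMinor G x a =
      (1 + 2 * x) * (shiftedLap (deleteVert G v) x + pairMatrix a b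
        (x - x ^ 2 / (1 + 2 * x) + r) (x - x ^ 2 / (1 + 2 * x)) (-(x ^ 2 / (1 + 2 * x)))).det := by
  have hdeg : G.degree v = 2 := by
    rw [← card_neighborFinset_eq_degree, hv, Finset.card_pair (Subtype.coe_ne_coe.2 hab)]
  have hind : neighborIndicator G v = Pi.single a 1 + Pi.single b 1 := by
    ext y
    have hne : ¬(y = a ∧ y = b) := fun h => hab (h.1.symm.trans h.2)
    simp only [neighborIndicator, adjMatrix_apply, ← mem_neighborFinset, hv, Finset.mem_insert,
      Finset.mem_singleton, Subtype.coe_inj, Pi.add_apply, Pi.single_apply]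
    grind
  have hpos : 1 + 2 * x ≠ 0 := by positivity
  rw [← det_shiftedLap_add_diagonal_single, det_shiftedLap_add_diagonal G v (by
    simpa [hdeg, a.2.symm, mul_comm] using hpos), hind, hdeg]
  simp only [Pi.single_eq_of_ne a.2.symm, Nat.cast_ofNat, add_zero, mul_comm x 2]
  congr 3
  ext i j
  simp [pairMatrix, vecMulVec_apply, single_apply, diagonal_apply, Pi.single_apply, Subtype.coe_inj]
  grind

section Bounds

variable (hab : a ≠ b) (hv : G.neighborFinset v = {↑a, ↑b}) (hnadj : ¬G.Adj a b)
include hab hv hnadj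

theorem lapDet_add_mul_lapMinor_eq_suppress (hx : 0 ≤ x) (r : ℝ) :
    lapDet G x + r * lapMinor G x a =
      (1 + x) * lapDet (suppress G v a b) x + (x + r * (1 + x)) * lapMinor (suppress G v a b) x a +
        x * (lapDet (deleteVert G v) x - (1 - r) * lapMinor (deleteVert G v) x a +
          2 * lapDet (deleteVert G v) x * (shiftedLap (deleteVert G v) x)⁻¹ a b) := by
  have hpos : 1 + 2 * x ≠ 0 := by positivity
  have hunit := isUnit_det_shiftedLap (deleteVert G v) hx
  have hsymm := isSymm_shiftedLap (deleteVert G v) x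
  have hsup (s : ℝ) := lapDet_suppress_add_mul_lapMinor (x := x) (v := v) hab hnadj s
  have hG := lapDet_add_mul_lapMinor_of_degree_two hab hv hx r
  simp only [det_add_pairMatrix hunit hsymm] at hsup hG
  rw [lapMinor_eq_lapDet_mul_inv (deleteVert G v) hx, lapDet.eq_def (deleteVert G v) x]
  have hsup0 := hsup 0
  have hsup1 := hsup 1
  field_simp at hG
  refine mul_left_cancel₀ hpos ?_
  linear_combination hG - (1 + 2 * x) * ((1 + x) - (x + r * (1 + x))) * hsup0 -
    (1 + 2 * x) * (x + r * (1 + x)) * hsup1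

theorem mul_lapMinor_suppress_lt (hx : 0 < x) :
    (1 + x) * lapMinor (suppress G v a b) x a < lapMinor G x a := by
  have hdel := mul_pos hx (lapMinor_pos (deleteVert G v) hx.le a)
  have hG (r : ℝ) := lapDet_add_mul_lapMinor_eq_suppress hab hv hnadj hx.le r
  linarith [hG 0, hG 1]

theorem lapDet_suppress_add_lt (hx : 0 < x) (ha : 0 < (deleteVert G v).degree a) :
    (1 + x) * lapDet (suppress G v a b) x + x * lapMinor (suppress G v a b) x a < lapDet G x := by
  have hlt := lapMinor_lt_lapDet (deleteVert G v) hx ha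
  have hinv := mul_nonneg (lapDet_pos (deleteVert G v) hx.le).le
    (inv_shiftedLap_nonneg (deleteVert G v) hx.le a b)
  have hgap : 0 < x * (lapDet (deleteVert G v) x - lapMinor (deleteVert G v) x a +
      2 * (lapDet (deleteVert G v) x * (shiftedLap (deleteVert G v) x)⁻¹ a b)) :=
    mul_pos hx (by linarith)
  linarith [lapDet_add_mul_lapMinor_eq_suppress hab hv hnadj hx.le 0]

end Bounds

end Suppression

section StarC4

open Matrix SimpleGraph

instance decidableRelAdjStarC4 (n : ℕ) : DecidableRel (starC4 n).Adj
  | .inl i, .inl j => inferInstanceAs (Decidable ((cycleGraph 4).Adj i j))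
  | .inl i, .inr _ => inferInstanceAs (Decidable (i = 3))
  | .inr _, .inl i => inferInstanceAs (Decidable (i = 3))
  | .inr _, .inr _ => inferInstanceAs (Decidable False)

variable (n : ℕ)

theorem starC4_adj_inl_inl (i j : Fin 4) :
    (starC4 n).Adj (.inl i) (.inl j) ↔ (cycleGraph 4).Adj i j := Iff.rfl

theorem starC4_adj_inl_inr (i : Fin 4) (j : Fin (n - 4)) :
    (starC4 n).Adj (.inl i) (.inr j) ↔ i = 3 := Iff.rfl

theorem starC4_adj_inr_inl (i : Fin (n - 4)) (j : Fin 4) :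
    (starC4 n).Adj (.inr i) (.inl j) ↔ j = 3 := Iff.rfl

theorem not_starC4_adj_inr_inr (i j : Fin (n - 4)) : ¬(starC4 n).Adj (.inr i) (.inr j) := id

/-- The proper 2-colouring of `S₄'`: it alternates around the cycle. -/
def starC4Coloring : (starC4 n).Coloring Bool :=
  Coloring.mk (Sum.elim (fun i => decide (i.val % 2 = 1)) fun _ => false) (by
    have halternate : ∀ i j : Fin 4, (cycleGraph 4).Adj i j →
        decide (i.val % 2 = 1) ≠ decide (j.val % 2 = 1) := by decide
    rintro (i | i) (j | j) h
    · exact halternate i j h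
    · simp [(starC4_adj_inl_inr n i j).1 h]
    · simp [(starC4_adj_inr_inl n i j).1 h]
    · exact absurd h (not_starC4_adj_inr_inr n i j))

theorem starC4_connected : (starC4 n).Connected := by
  let cycleHom : cycleGraph 4 →g starC4 n := ⟨Sum.inl, id⟩
  have hcenter : ∀ a, (starC4 n).Reachable a (.inl 3)
    | .inl i => (cycleGraph_preconnected i 3).map cycleHom
    | .inr j => Adj.reachable ((starC4_adj_inr_inl n j 3).2 rfl)
  have : Nonempty (Fin 4 ⊕ Fin (n - 4)) := ⟨.inl 3⟩
  exact ⟨fun a b => (hcenter a).trans (hcenter b).symm⟩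

theorem starC4_degree_inl (i : Fin 4) :
    (starC4 n).degree (.inl i) = 2 + if i = 3 then n - 4 else 0 := by
  have hdeg := degree_eq_sum_if_adj (starC4 n) (R := ℕ) (.inl i)
  have hcycle := degree_eq_sum_if_adj (cycleGraph 4) (R := ℕ) i
  simp only [Nat.cast_id, Fintype.sum_sum_type, starC4_adj_inl_inl, starC4_adj_inl_inr]
    at hdeg hcycle
  rw [hdeg, ← hcycle, cycleGraph_degree_three_le, Finset.sum_const]
  simp

theorem starC4_degree_inr (j : Fin (n - 4)) : (starC4 n).degree (.inr j) = 1 := by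
  have hdeg := degree_eq_sum_if_adj (starC4 n) (R := ℕ) (.inr j)
  simp only [Nat.cast_id, Fintype.sum_sum_type, starC4_adj_inr_inl, not_starC4_adj_inr_inr] at hdeg
  simpa using hdeg

theorem starC4_isUnicyclic : (starC4 n).IsUnicyclic := by
  refine ⟨starC4_connected n, ?_⟩
  have hsum := (starC4 n).sum_degrees_eq_twice_card_edges
  simp only [Fintype.sum_sum_type, starC4_degree_inl, starC4_degree_inr, Finset.sum_add_distrib,
    Finset.sum_ite_eq', Finset.sum_const, Finset.card_univ, Fintype.card_fin, Finset.mem_univ,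
    if_true, smul_eq_mul] at hsum
  rw [← coe_edgeFinset, Set.ncard_coe_finset, Fintype.card_sum, Fintype.card_fin, Fintype.card_fin]
  omega

theorem shiftedLap_starC4 (x : ℝ) :
    shiftedLap (starC4 n) x = fromBlocks
      (shiftedLap (cycleGraph 4) x + single 3 3 ((n - 4 : ℕ) * x))
      (vecMulVec (Pi.single 3 (-x)) 1) (vecMulVec 1 (Pi.single 3 (-x)))
      (diagonal fun _ => 1 + x) := by
  ext (i | i) (j | j)
  · obtain rfl | hij := eq_or_ne i j
    · simp only [shiftedLap_apply_self, starC4_degree_inl, fromBlocks_apply₁₁, Matrix.add_apply,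
        cycleGraph_degree_three_le, single_apply]
      split_ifs <;> simp_all
      ring
    · have hne : ¬(3 = i ∧ 3 = j) := fun h => hij (h.1.symm.trans h.2)
      simp [shiftedLap_apply_of_ne, hij, starC4_adj_inl_inl, adjMatrix_apply, hne]
  · simp [shiftedLap_apply_of_ne, starC4_adj_inl_inr, adjMatrix_apply, Pi.single_apply, neg_ite]
  · simp [shiftedLap_apply_of_ne, starC4_adj_inr_inl, adjMatrix_apply, Pi.single_apply, neg_ite]
  · obtain rfl | hij := eq_or_ne i j
    · simp [shiftedLap_apply_self, starC4_degree_inr]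
    · simp [shiftedLap_apply_of_ne, hij, not_starC4_adj_inr_inr, adjMatrix_apply]

theorem vecMulVec_mul_diagonal_mul_vecMulVec {ι κ R : Type*} [CommSemiring R] [Fintype κ]
    [DecidableEq κ] (u v : ι → R) (a b d : κ → R) :
    vecMulVec u a * (diagonal d * vecMulVec b v) = (∑ k, a k * d k * b k) • vecMulVec u v := by
  ext i j
  rw [mul_apply]
  simp only [diagonal_mul, vecMulVec_apply, Matrix.smul_apply, smul_eq_mul,
    Finset.sum_mul]
  exact Finset.sum_congr rfl fun k _ => by ring

theorem lapDet_add_mul_lapMinor_starC4 {x : ℝ} (hx : 0 ≤ x) (r : ℝ) :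
    lapDet (starC4 n) x + r * lapMinor (starC4 n) x (.inl 3) = (1 + x) ^ (n - 4) *
      (lapDet (cycleGraph 4) x +
        ((n - 4 : ℕ) * (x / (1 + x)) + r) * lapMinor (cycleGraph 4) x 3) := by
  have hpos : 1 + x ≠ 0 := by positivity
  let _ : Invertible (diagonal fun _ : Fin (n - 4) => 1 + x) :=
    { invOf := diagonal fun _ => (1 + x)⁻¹
      invOf_mul_self := by simp [hpos]
      mul_invOf_self := by simp [hpos] }
  have hinv : ⅟(diagonal fun _ : Fin (n - 4) => 1 + x) = diagonal fun _ => (1 + x)⁻¹ := rfl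
  have hsingle : diagonal (Pi.single (.inl 3 : Fin 4 ⊕ Fin (n - 4)) r) =
      fromBlocks (single 3 3 r) 0 0 0 := by
    rw [← diagonal_single, ← diagonal_zero, fromBlocks_diagonal]
    congr 1
    ext (i | i) <;> simp [Pi.single_apply]
  have hcorner : vecMulVec (Pi.single 3 (-x)) (Pi.single 3 (-x)) =
      single (3 : Fin 4) (3 : Fin 4) (x ^ 2) := by
    ext i j
    simp [vecMulVec_apply, single_apply, Pi.single_apply]
    grind
  rw [← det_shiftedLap_add_diagonal_single, ← det_shiftedLap_add_diagonal_single,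
    shiftedLap_starC4, hsingle, fromBlocks_add, add_zero, add_zero, add_zero, det_fromBlocks₂₂,
    hinv, det_diagonal, Matrix.mul_assoc, vecMulVec_mul_diagonal_mul_vecMulVec, hcorner,
    diagonal_single, smul_single, add_assoc, ← single_add, sub_eq_add_neg, single_neg, add_assoc,
    ← single_add]
  simp only [Pi.one_apply, one_mul, mul_one, Finset.prod_const, Finset.sum_const, Finset.card_univ,
    Fintype.card_fin, smul_eq_mul, nsmul_eq_mul]
  congr 4
  field_simp
  ring

theorem lapMinor_starC4 {x : ℝ} (hx : 0 ≤ x) :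
    lapMinor (starC4 n) x (.inl 3) = (1 + x) ^ (n - 4) * lapMinor (cycleGraph 4) x 3 := by
  linear_combination lapDet_add_mul_lapMinor_starC4 n hx 1 - lapDet_add_mul_lapMinor_starC4 n hx 0

variable {n} in
theorem lapMinor_starC4_succ {x : ℝ} (hx : 0 ≤ x) (hn : 4 ≤ n) :
    lapMinor (starC4 (n + 1)) x (.inl 3) = (1 + x) * lapMinor (starC4 n) x (.inl 3) := by
  rw [lapMinor_starC4 _ hx, lapMinor_starC4 _ hx, Nat.sub_add_comm hn, pow_succ']
  ring

variable {n} in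
theorem lapDet_starC4_succ {x : ℝ} (hx : 0 ≤ x) (hn : 4 ≤ n) :
    lapDet (starC4 (n + 1)) x =
      (1 + x) * lapDet (starC4 n) x + x * lapMinor (starC4 n) x (.inl 3) := by
  have hpos : 1 + x ≠ 0 := by positivity
  have hdet (m : ℕ) := lapDet_add_mul_lapMinor_starC4 m hx 0
  simp only [zero_mul, add_zero] at hdet
  rw [hdet, hdet, lapMinor_starC4 _ hx, Nat.sub_add_comm hn, pow_succ', Nat.cast_succ]
  field_simp
  ring

end StarC4

section StarC4Iso

open SimpleGraph

theorem exists_equiv_sum_fin {α V : Type*} [Fintype α] [Fintype V] {m : ℕ} {g : α → V}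
    (hg : Function.Injective g) (hcard : Fintype.card V = Fintype.card α + m) :
    ∃ f : α ⊕ Fin m ≃ V, ∀ i, f (.inl i) = g i := by
  classical
  have hcompl : Fintype.card ↥(Set.range g)ᶜ = m := by
    rw [Fintype.card_compl_set, Set.card_range_of_injective hg, hcard, Nat.add_sub_cancel_left]
  exact ⟨((Equiv.ofInjective g hg).sumCongr (Fintype.equivFinOfCardEq hcompl).symm).trans
    (Equiv.Set.sumCompl _), fun i => by simp⟩

variable {V : Type*} [Fintype V] [DecidableEq V] {G : SimpleGraph V} [DecidableRel G.Adj] {c : V}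

omit [DecidableEq V] in
theorem exists_eq_iff_not_adj_of_degree_add_two (hc : G.degree c + 2 = Fintype.card V) :
    ∃ o, ∀ y, y = o ↔ y ≠ c ∧ ¬G.Adj c y := by
  classical
  have hnmem : c ∉ G.neighborFinset c := by simp
  obtain ⟨o, ho⟩ : ∃ o, (insert c (G.neighborFinset c))ᶜ = {o} := by
    rw [← Finset.card_eq_one, Finset.card_compl, Finset.card_insert_of_notMem hnmem,
      card_neighborFinset_eq_degree]
    omega
  exact ⟨o, fun y => by rw [← Finset.mem_singleton, ← ho]; simp⟩

theorem isBipartiteWith_pair_neighborFinset (hindep : G.IsIndepSet (G.neighborSet c)) {o : V}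
    (ho : ∀ y, y = o ↔ y ≠ c ∧ ¬G.Adj c y) :
    G.IsBipartiteWith ({c, o} : Finset V) (G.neighborFinset c) := by
  have hco : ¬G.Adj c o := ((ho o).1 rfl).2
  have hmem (y : V) : y = c ∨ y = o ∨ G.Adj c y := by
    have := ho y
    tauto
  refine ⟨?_, fun y z hyz => ?_⟩
  · rw [Finset.disjoint_coe, Finset.disjoint_left]
    rintro y hy
    obtain rfl | rfl : y = c ∨ y = o := by simpa using hy
    · simp
    · simpa using hco
  · have hnot : ¬(G.Adj c y ∧ G.Adj c z) := fun h => hindep h.1 h.2 hyz.ne hyz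
    simp only [Finset.mem_coe, Finset.mem_insert, Finset.mem_singleton, mem_neighborFinset]
    have hy := hmem y
    have hz := hmem z
    grind [SimpleGraph.adj_comm, SimpleGraph.irrefl]

theorem exists_neighborFinset_eq_pair (hindep : G.IsIndepSet (G.neighborSet c))
    (hsum : ∑ v, G.degree v = 2 * Fintype.card V) (hc : G.degree c + 2 = Fintype.card V) {o : V}
    (ho : ∀ y, y = o ↔ y ≠ c ∧ ¬G.Adj c y) :
    ∃ p q, p ≠ q ∧ G.neighborFinset o = {p, q} := by
  have hedges := isBipartiteWith_sum_degrees_eq_card_edges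
    (isBipartiteWith_pair_neighborFinset hindep ho)
  rw [Finset.sum_pair ((ho o).1 rfl).1.symm] at hedges
  rw [sum_degrees_eq_twice_card_edges] at hsum
  rw [← Finset.card_eq_two, card_neighborFinset_eq_degree]
  omega

omit [Fintype V] [DecidableEq V] [DecidableRel G.Adj] in
theorem adj_iff_starC4_adj_of_equiv {n : ℕ} (f : Fin 4 ⊕ Fin (n - 4) ≃ V)
    (hindep : G.IsIndepSet (G.neighborSet (f (.inl 3))))
    (hcenter : ∀ y, G.Adj (f (.inl 3)) y ↔ y ≠ f (.inl 3) ∧ y ≠ f (.inl 1))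
    (hopposite : ∀ y, G.Adj (f (.inl 1)) y ↔ y = f (.inl 0) ∨ y = f (.inl 2))
    (i j : Fin 4 ⊕ Fin (n - 4)) : G.Adj (f i) (f j) ↔ (starC4 n).Adj i j := by
  have hc (k) : G.Adj (f (.inl 3)) (f k) ↔ k ≠ .inl 3 ∧ k ≠ .inl 1 := by
    rw [hcenter, f.injective.ne_iff, f.injective.ne_iff]
  have ho (k) : G.Adj (f (.inl 1)) (f k) ↔ k = .inl 0 ∨ k = .inl 2 := by
    rw [hopposite, f.injective.eq_iff, f.injective.eq_iff]
  have hrest (k l) (hk : k ≠ .inl 3 ∧ k ≠ .inl 1) (hl : l ≠ .inl 3 ∧ l ≠ .inl 1) :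
      ¬G.Adj (f k) (f l) := fun h => hindep ((hc k).2 hk) ((hc l).2 hl) h.ne h
  have hc' (k) := (G.adj_comm (f k) (f (.inl 3))).trans (hc k)
  have ho' (k) := (G.adj_comm (f k) (f (.inl 1))).trans (ho k)
  rcases i with i | i <;> rcases j with j | j
  · rw [starC4_adj_inl_inl]
    have hcycle : ∀ i j : Fin 4, (cycleGraph 4).Adj i j ↔
        ¬((i = 1 ∨ i = 3) ↔ (j = 1 ∨ j = 3)) := by decide
    fin_cases i <;> fin_cases j <;> simp [hc, ho, hc', ho', hrest, hcycle]
  · rw [starC4_adj_inl_inr]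
    fin_cases i <;> simp [hc, ho, hrest]
  · rw [starC4_adj_inr_inl, adj_comm]
    fin_cases j <;> simp [hc, ho, hrest]
  · simp [not_starC4_adj_inr_inr, hrest]

omit [DecidableEq V] in
theorem exists_iso_starC4 {n : ℕ} (hcard : Fintype.card V = n)
    (hindep : G.IsIndepSet (G.neighborSet c)) (hsum : ∑ v, G.degree v = 2 * n)
    (hc : G.degree c + 2 = n) : ∃ f : starC4 n ≃g G, f (.inl 3) = c := by
  classical
  subst hcard
  obtain ⟨o, ho⟩ := exists_eq_iff_not_adj_of_degree_add_two hc
  obtain ⟨p, q, hpq, hpqo⟩ := exists_neighborFinset_eq_pair hindep hsum hc ho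
  have hoadj (y : V) : G.Adj o y ↔ y = p ∨ y = q := by
    rw [← mem_neighborFinset, hpqo, Finset.mem_insert, Finset.mem_singleton]
  have hcadj (y : V) : G.Adj c y ↔ y ≠ c ∧ y ≠ o := by
    have := ho y
    have := G.irrefl (v := c)
    grind
  obtain ⟨hoc, hnco⟩ := (ho o).1 rfl
  have hop := (hoadj p).2 (.inl rfl)
  have hoq := (hoadj q).2 (.inr rfl)
  have hpc : p ≠ c := fun h => hnco (h ▸ hop.symm)
  have hqc : q ≠ c := fun h => hnco (h ▸ hoq.symm)
  have hinj : Function.Injective ![p, o, q, c] := by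
    have := hop.ne
    have := hoq.ne
    intro i j
    fin_cases i <;> fin_cases j <;> simp <;> tauto
  have hcard : Fintype.card V = Fintype.card (Fin 4) + (Fintype.card V - 4) := by
    have := Fintype.card_le_of_injective _ hinj
    rw [Fintype.card_fin] at *
    omega
  obtain ⟨f, hf⟩ := exists_equiv_sum_fin hinj hcard
  have hf0 : f (.inl 0) = p := hf 0
  have hf1 : f (.inl 1) = o := hf 1
  have hf2 : f (.inl 2) = q := hf 2
  have hf3 : f (.inl 3) = c := hf 3
  exact ⟨⟨f, @fun i j => adj_iff_starC4_adj_of_equiv f (by rwa [hf3])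
    (by simpa only [hf3, hf1] using hcadj) (by simpa only [hf0, hf1, hf2] using hoadj) i j⟩, hf3⟩

end StarC4Iso

section IsoInvariance

open Matrix SimpleGraph

variable {V W : Type*} [Fintype V] [DecidableEq V] [Fintype W] [DecidableEq W]
  {G : SimpleGraph V} [DecidableRel G.Adj] {H : SimpleGraph W} [DecidableRel H.Adj]

theorem shiftedLap_submatrix_iso (f : G ≃g H) (x : ℝ) :
    (shiftedLap H x).submatrix f f = shiftedLap G x := by
  ext i j
  rw [submatrix_apply]
  obtain rfl | hij := eq_or_ne i j
  · simp only [shiftedLap_apply_self, f.degree_eq]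
  · rw [shiftedLap_apply_of_ne _ _ hij, shiftedLap_apply_of_ne _ _ (f.injective.ne hij),
      adjMatrix_apply, adjMatrix_apply]
    simp only [f.map_adj_iff]

theorem lapDet_iso (f : G ≃g H) (x : ℝ) : lapDet H x = lapDet G x := by
  rw [lapDet, lapDet, ← shiftedLap_submatrix_iso f x]
  exact (det_submatrix_equiv_self f.toEquiv _).symm

theorem lapMinor_iso (f : G ≃g H) (x : ℝ) (u : V) : lapMinor H x (f u) = lapMinor G x u := by
  rw [lapMinor, lapMinor, ← shiftedLap_submatrix_iso f x]
  exact congrFun₂ (adjugate_submatrix_equiv_self f.toEquiv _) u u |>.symm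

end IsoInvariance

section RegularGraph

open SimpleGraph

variable {V : Type*} {G : SimpleGraph V}

theorem connected_of_surjective_of_adj_reachable {W : Type*} {H : SimpleGraph W}
    (hG : G.Connected) {f : V → W} (hf : Function.Surjective f)
    (h : ∀ y z, G.Adj y z → H.Reachable (f y) (f z)) : H.Connected := by
  have hmap (y z : V) : H.Reachable (f y) (f z) := by
    simp only [reachable_iff_reflTransGen] at h ⊢
    exact ((reachable_iff_reflTransGen y z).1 (hG.preconnected y z)).lift' f h
  have := hG.nonempty.map f
  exact ⟨hf.forall₂.2 hmap⟩

theorem connected_suppress [DecidableEq V] (hG : G.Connected) {v : V} [Fintype (G.neighborSet v)]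
    {a b : {y // y ≠ v}} (hab : a ≠ b) (hv : G.neighborFinset v = {↑a, ↑b}) :
    (suppress G v a b).Connected := by
  let f (y : V) : {y // y ≠ v} := if h : y = v then a else ⟨y, h⟩
  have hfv : f v = a := dif_pos rfl
  have hf (y : {y // y ≠ v}) : f y = y := dif_neg y.2
  have hedge : (suppress G v a b).Adj a b := by simp [edge_adj, hab]
  have hadj (y : V) (hy : G.Adj v y) : (suppress G v a b).Reachable a (f y) := by
    rw [← mem_neighborFinset, hv, Finset.mem_insert, Finset.mem_singleton] at hy
    obtain rfl | rfl := hy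
    · rw [hf]
    · rw [hf]
      exact hedge.reachable
  refine connected_of_surjective_of_adj_reachable hG (fun y => ⟨y, hf y⟩) fun y z hyz => ?_
  by_cases hy : y = v
  · subst hy
    exact hfv ▸ hadj z hyz
  by_cases hz : z = v
  · subst hz
    exact hfv ▸ (hadj y hyz.symm).symm
  · rw [hf ⟨y, hy⟩, hf ⟨z, hz⟩]
    exact Adj.reachable (.inl hyz)

variable [Fintype V] [DecidableRel G.Adj]

theorem cliqueFree_of_isRegularOfDegree {d : ℕ} (hG : G.Connected) (hreg : G.IsRegularOfDegree d)
    (hcard : d + 1 < Fintype.card V) : G.CliqueFree (d + 1) := by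
  classical
  rintro s ⟨hs, hsd⟩
  have hclosed (y) (hy : y ∈ s) (z) (hyz : G.Adj y z) : z ∈ s := by
    have hsub : s.erase y ⊆ G.neighborFinset y := fun z hz => by
      rw [Finset.mem_erase] at hz
      exact (G.mem_neighborFinset y z).2 (hs hy hz.2 hz.1.symm)
    have heq := Finset.eq_of_subset_of_card_le hsub (by
      rw [card_neighborFinset_eq_degree, hreg.degree_eq, Finset.card_erase_of_mem hy, hsd]; rfl)
    exact Finset.mem_of_mem_erase (heq ▸ (G.mem_neighborFinset y z).2 hyz)
  obtain ⟨y, hy⟩ : s.Nonempty := Finset.card_pos.1 (by omega)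
  obtain ⟨z, -, hz⟩ := Finset.exists_mem_notMem_of_card_lt_card (hsd.trans_lt hcard)
  obtain ⟨p⟩ := hG.preconnected y z
  obtain ⟨e, -, he, he'⟩ := p.exists_boundary_dart s hy hz
  exact he' (hclosed _ he _ e.adj)

end RegularGraph

section LapBounds

open SimpleGraph

variable {V : Type*} [Fintype V] [DecidableEq V] {G : SimpleGraph V} [DecidableRel G.Adj]

theorem degree_sup_edge {a b : V} (hab : a ≠ b) (hnadj : ¬G.Adj a b) (y : V) :
    (G ⊔ edge a b).degree y = G.degree y + if y = a ∨ y = b then 1 else 0 := by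
  have hnadj' : ¬G.Adj b a := fun h => hnadj h.symm
  have hsup := degree_eq_sum_if_adj (G ⊔ edge a b) (R := ℕ) y
  have hdeg := degree_eq_sum_if_adj G (R := ℕ) y
  rw [Nat.cast_id] at hsup hdeg
  have hadj (z : V) : (if (G ⊔ edge a b).Adj y z then 1 else 0) = (if G.Adj y z then 1 else 0) +
      ((if z = b then if y = a then 1 else 0 else 0) +
        if z = a then if y = b then 1 else 0 else 0) := by
    simp only [sup_adj, edge_adj]
    grind
  rw [hsup, hdeg]
  simp only [hadj, Finset.sum_add_distrib, Finset.sum_ite_eq', Finset.mem_univ, if_true]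
  grind

theorem isRegularOfDegree_suppress {d : ℕ} (hreg : G.IsRegularOfDegree d) {v : V}
    {a b : {y // y ≠ v}} (hab : a ≠ b) (hv : G.neighborFinset v = {↑a, ↑b})
    (hnadj : ¬G.Adj a b) : (suppress G v a b).IsRegularOfDegree d := by
  intro y
  have hvy : G.Adj v y ↔ y = a ∨ y = b := by
    rw [← mem_neighborFinset, hv, Finset.mem_insert, Finset.mem_singleton, Subtype.ext_iff,
      Subtype.ext_iff]
  rw [← hreg y, ← degree_deleteVert_add, degree_sup_edge hab hnadj]
  simp only [hvy]

theorem sum_degrees_deleteVert (v : V) :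
    ∑ y, (deleteVert G v).degree y + 2 * G.degree v = ∑ y, G.degree y := by
  have hv : G.degree v = ∑ y : {y // y ≠ v}, if G.Adj v y then 1 else 0 := by
    have hdeg := degree_eq_sum_if_adj G (R := ℕ) v
    rw [Fintype.sum_eq_add_sum_subtype_ne _ v] at hdeg
    simpa using hdeg
  rw [Fintype.sum_eq_add_sum_subtype_ne (fun y => G.degree y) v]
  simp only [← degree_deleteVert_add G v, Finset.sum_add_distrib, ← hv]
  ring

omit [DecidableEq V] in
theorem four_le_card_of_cliqueFree_three [Nonempty V] (hfree : G.CliqueFree 3)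
    (hsum : ∑ v, G.degree v = 2 * Fintype.card V) : 4 ≤ Fintype.card V := by
  have hpos : 0 < Fintype.card V := Fintype.card_pos
  have hturan := hfree.card_edgeFinset_le
  rw [sum_degrees_eq_twice_card_edges] at hsum
  rw [mul_left_cancel₀ two_ne_zero hsum] at hturan
  by_contra! hlt
  interval_cases Fintype.card V <;> simp at hturan

/-- `det (1 + x L(G))` and its principal minors are at least those of `S₄'` of order `n`, where the
minor of `S₄'` is taken at its centre; equality forces a vertex of degree `n - 2`. -/
structure StarC4LapBounds (G : SimpleGraph V) [DecidableRel G.Adj] (x : ℝ) (n : ℕ) : Prop where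
  minor_le (u : V) : lapMinor (starC4 n) x (.inl 3) ≤ lapMinor G x u
  minor_lt (u : V) : G.degree u + 2 ≠ n → lapMinor (starC4 n) x (.inl 3) < lapMinor G x u
  det_le : lapDet (starC4 n) x ≤ lapDet G x
  det_lt : (∀ u, G.degree u + 2 ≠ n) → lapDet (starC4 n) x < lapDet G x

section Step

variable {x : ℝ} (hx : 0 < x) {n : ℕ}
include hx

theorem StarC4LapBounds.of_leaf {v : V} {w : {y // y ≠ v}} (hn : 4 ≤ n)
    (hw : G.neighborFinset v = {↑w}) (hdeg : 0 < (deleteVert G v).degree w)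
    (ih : StarC4LapBounds (deleteVert G v) x n) : StarC4LapBounds G x (n + 1) := by
  have hvw : G.Adj v w := by rw [← mem_neighborFinset, hw, Finset.mem_singleton]
  have hdegw : (deleteVert G v).degree w + 1 = G.degree w := by
    rw [← degree_deleteVert_add G v w, if_pos hvw]
  have hdet := lapDet_leaf hw hx.le
  have hdet_succ := lapDet_starC4_succ hx.le hn
  have hminor_succ := lapMinor_starC4_succ hx.le hn
  have hminor_self : lapMinor (starC4 (n + 1)) x (.inl 3) < lapMinor G x v := by
    have := lapMinor_leaf_self hw hx.le
    have := lapMinor_lt_lapDet (deleteVert G v) hx hdeg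
    have := ih.minor_le w
    nlinarith
  have hminor_ne (u : {y // y ≠ v}) (hu : u ≠ w) :
      lapMinor (starC4 (n + 1)) x (.inl 3) < lapMinor G x u := by
    have := mul_lapMinor_lt_lapMinor_leaf hw hx hu
    have := ih.minor_le u
    nlinarith
  have hminor_neighbor := lapMinor_leaf_neighbor hw hx.le
  refine ⟨fun u => ?_, fun u hu => ?_, ?_, fun hne => ?_⟩
  · obtain rfl | huv := eq_or_ne u v
    · exact hminor_self.le
    obtain rfl | huw := eq_or_ne ⟨u, huv⟩ w
    · rw [hminor_succ, hminor_neighbor]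
      gcongr
      exact ih.minor_le _
    · exact (hminor_ne ⟨u, huv⟩ huw).le
  · obtain rfl | huv := eq_or_ne u v
    · exact hminor_self
    obtain rfl | huw := eq_or_ne ⟨u, huv⟩ w
    · rw [hminor_succ, hminor_neighbor]
      have hu' : G.degree (⟨u, huv⟩ : {y // y ≠ v}) + 2 ≠ n + 1 := hu
      gcongr
      exact ih.minor_lt _ (by omega)
    · exact hminor_ne ⟨u, huv⟩ huw
  · rw [hdet, hdet_succ]
    gcongr
    exacts [ih.det_le, ih.minor_le w]
  · have hw_ne := hne w
    rw [hdet, hdet_succ]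
    have hminor := ih.minor_lt w (by omega)
    exact add_lt_add_of_le_of_lt (mul_le_mul_of_nonneg_left ih.det_le (by positivity))
      (mul_lt_mul_of_pos_left hminor hx)

theorem StarC4LapBounds.starC4_succ_lt_of_suppress {v : V} {a b : {y // y ≠ v}} (hn : 4 ≤ n)
    (hab : a ≠ b) (hv : G.neighborFinset v = {↑a, ↑b}) (hnadj : ¬G.Adj a b)
    (ha : 0 < (deleteVert G v).degree a) (h : StarC4LapBounds (suppress G v a b) x n) :
    lapMinor (starC4 (n + 1)) x (.inl 3) < lapMinor G x a ∧
      lapDet (starC4 (n + 1)) x < lapDet G x := by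
  rw [lapMinor_starC4_succ hx.le hn, lapDet_starC4_succ hx.le hn]
  constructor
  · refine (mul_le_mul_of_nonneg_left (h.minor_le a) (by positivity)).trans_lt
      (mul_lapMinor_suppress_lt hab hv hnadj hx)
  · refine (add_le_add (mul_le_mul_of_nonneg_left h.det_le (by positivity))
      (mul_le_mul_of_nonneg_left (h.minor_le a) hx.le)).trans_lt
      (lapDet_suppress_add_lt hab hv hnadj hx ha)

omit hx in
theorem StarC4LapBounds.of_card_eq_four (hcard : Fintype.card V = 4) (hG : G.Connected)
    (hreg : G.IsRegularOfDegree 2) : StarC4LapBounds G x 4 := by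
  have hfree : G.CliqueFree 3 := cliqueFree_of_isRegularOfDegree hG hreg (by omega)
  have hiso (u : V) : ∃ f : starC4 4 ≃g G, f (.inl 3) = u :=
    exists_iso_starC4 hcard (isIndepSet_neighborSet_of_triangleFree G hfree u)
      (by simp [hreg.degree_eq, hcard]) (by rw [hreg.degree_eq])
  have hminor (u : V) : lapMinor (starC4 4) x (.inl 3) = lapMinor G x u := by
    obtain ⟨f, rfl⟩ := hiso u
    exact (lapMinor_iso f x _).symm
  obtain ⟨u⟩ := hG.nonempty
  obtain ⟨f, -⟩ := hiso u
  exact ⟨fun u => (hminor u).le, fun u hu => absurd (by rw [hreg.degree_eq]) hu,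
    (lapDet_iso f x).ge, fun hne => absurd (by rw [hreg.degree_eq]) (hne u)⟩

theorem StarC4LapBounds.of_isRegularOfDegree_two (hn : 4 ≤ n) (hcard : Fintype.card V = n)
    (hG : G.Connected) (hreg : G.IsRegularOfDegree 2) : StarC4LapBounds G x n := by
  induction n, hn using Nat.le_induction generalizing V with
  | base => exact .of_card_eq_four hcard hG hreg
  | succ n hn ih =>
    have hfree : G.CliqueFree 3 := cliqueFree_of_isRegularOfDegree hG hreg (by omega)
    have hlt (u : V) : lapMinor (starC4 (n + 1)) x (.inl 3) < lapMinor G x u ∧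
        lapDet (starC4 (n + 1)) x < lapDet G x := by
      obtain ⟨v, huv⟩ := (G.degree_pos_iff_exists_adj u).1 (by simp [hreg.degree_eq])
      obtain ⟨b, hub, hv⟩ : ∃ b, u ≠ b ∧ G.neighborFinset v = {u, b} := by
        obtain ⟨b, hb⟩ : ∃ b, (G.neighborFinset v).erase u = {b} := by
          rw [← Finset.card_eq_one, Finset.card_erase_of_mem (by simpa using huv.symm),
            G.card_neighborFinset_eq_degree, hreg.degree_eq]
        exact ⟨b, (Finset.ne_of_mem_erase (hb ▸ Finset.mem_singleton_self b)).symm,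
          by rw [← hb, Finset.insert_erase (by simpa using huv.symm)]⟩
      have hvb : G.Adj v b := by simp [← mem_neighborFinset, hv]
      let a' : {y // y ≠ v} := ⟨u, huv.ne⟩
      let b' : {y // y ≠ v} := ⟨b, hvb.ne'⟩
      have hab : a' ≠ b' := fun h => hub (congrArg Subtype.val h)
      have hnadj : ¬G.Adj u b :=
        isIndepSet_neighborSet_of_triangleFree G hfree v huv.symm hvb hub
      have hpos : 0 < (deleteVert G v).degree a' := by
        have := degree_deleteVert_add G v a'
        rw [hreg.degree_eq] at this
        split_ifs at this <;> omega
      exact starC4_succ_lt_of_suppress hx hn hab hv hnadj hpos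
        (ih (by simp [hcard]) (connected_suppress hG hab hv)
          (isRegularOfDegree_suppress hreg hab hv hnadj))
    obtain ⟨u⟩ := hG.nonempty
    exact ⟨fun u => (hlt u).1.le, fun u _ => (hlt u).1, (hlt u).2.le, fun _ => (hlt u).2⟩

theorem StarC4LapBounds.of_cliqueFree_three (hcard : Fintype.card V = n) (hG : G.Connected)
    (hsum : ∑ v, G.degree v = 2 * n) (hfree : G.CliqueFree 3) : StarC4LapBounds G x n := by
  induction n generalizing V with
  | zero => exact absurd hcard (have := hG.nonempty; Fintype.card_ne_zero)
  | succ n ih =>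
    have := hG.nonempty
    have hfour := four_le_card_of_cliqueFree_three hfree (hcard ▸ hsum)
    by_cases hleaf : ∃ v, G.degree v = 1
    · obtain ⟨v, hdeg⟩ := hleaf
      have hcon : (deleteVert G v).Connected := hG.induce_compl_singleton_of_degree_eq_one hdeg
      have hdel : Fintype.card {y // y ≠ v} = n := by simp [hcard]
      have hsum' : ∑ y, (deleteVert G v).degree y = 2 * n := by
        have := sum_degrees_deleteVert (G := G) v
        omega
      have hfree' : (deleteVert G v).CliqueFree 3 :=
        hfree.comap ⟨(Embedding.comap (.subtype (· ≠ v)) G).toCopy⟩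
      have := hcon.nonempty
      have hn := four_le_card_of_cliqueFree_three hfree' (hdel ▸ hsum')
      have : Nontrivial {y // y ≠ v} := Fintype.one_lt_card_iff_nontrivial.1 (by omega)
      obtain ⟨w, hw⟩ := Finset.card_eq_one.1 ((G.card_neighborFinset_eq_degree v).trans hdeg)
      have hvw : G.Adj v w := by simp [← mem_neighborFinset, hw]
      exact .of_leaf hx (hdel ▸ hn) (w := ⟨w, hvw.ne'⟩) hw
        (hcon.preconnected.degree_pos_of_nontrivial _) (ih hdel hcon hsum' hfree')
    · have : Nontrivial V := Fintype.one_lt_card_iff_nontrivial.1 (by omega)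
      have htwo (v : V) : 2 ≤ G.degree v := by
        have := hG.preconnected.degree_pos_of_nontrivial v
        have : G.degree v ≠ 1 := fun h => hleaf ⟨v, h⟩
        omega
      refine .of_isRegularOfDegree_two hx (hcard ▸ hfour) hcard hG fun v => ?_
      refine ((Finset.sum_eq_sum_iff_of_le fun v _ => htwo v).1 ?_ v (Finset.mem_univ v)).symm
      rw [hsum, Finset.sum_const, Finset.card_univ, hcard, smul_eq_mul, mul_comm]

end Step

end LapBounds

section Energy

open SimpleGraph Matrix MeasureTheory
open Set (Ioi)

variable {V : Type*} {G : SimpleGraph V}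

/-- A single edge of the cycle is removed to leave a spanning tree. Its colouring extends to `G`,
since the rest of the even cycle is a path of odd length joining the ends of that edge. -/
theorem nonempty_coloring_bool_of_even_girth [Fintype V] (hG : G.IsUnicyclic)
    (heven : Even G.girth) : Nonempty (G.Coloring Bool) := by
  by_cases hac : G.IsAcyclic
  · exact ⟨hac.isBipartite.toColoring (by simp)⟩
  obtain ⟨a, w, hw, hlen⟩ := exists_girth_eq_length.2 hac
  rw [hlen] at heven
  cases w with
  | nil => exact absurd hw Walk.not_isCycle_nil
  | @cons _ b _ hab p =>
    have hp : s(a, b) ∉ p.edges := ((Walk.cons_isCycle_iff p hab).1 hw).2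
    have htree : (G.deleteEdges {s(a, b)}).IsTree := by
      refine isTree_iff_connected_and_card.2
        ⟨hG.1.connected_delete_edge_of_not_isBridge fun h => h.notMem_edges_of_isCycle hw (by simp),
          ?_⟩
      rw [Nat.card_coe_set_eq, edgeSet_deleteEdges,
        Set.ncard_sdiff_singleton_add_one (G.mem_edgeSet.2 hab), hG.2, Nat.card_eq_fintype_card]
    have c : (G.deleteEdges {s(a, b)}).Coloring Bool := htree.isBipartite.toColoring (by simp)
    have hodd : ¬Even (p.toDeleteEdge s(a, b) hp).length := by
      rw [Walk.length_cons, Nat.even_add_one] at heven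
      rwa [show (p.toDeleteEdge s(a, b) hp).length = p.length from Walk.length_transfer ..]
    have hcab : c a ≠ c b := fun h => hodd ((c.even_length_iff_congr _).2 (by rw [h]))
    refine ⟨Coloring.mk c fun {y z} hyz => ?_⟩
    by_cases hs : s(y, z) = s(a, b)
    · obtain ⟨rfl, rfl⟩ | ⟨rfl, rfl⟩ := Sym2.eq_iff.1 hs
      exacts [hcab, hcab.symm]
    · exact c.valid (deleteEdges_adj.2 ⟨hyz, by simpa using hs⟩)

theorem even_girth_of_coloring_bool (c : G.Coloring Bool) : Even G.girth := by
  by_cases hac : G.IsAcyclic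
  · simp [girth_eq_zero.2 hac]
  · obtain ⟨a, w, -, hlen⟩ := exists_girth_eq_length.2 hac
    rw [hlen, c.even_length_iff_congr]

variable [Fintype V]

section SignMatrix

variable [DecidableEq V]

/-- The diagonal `±1` matrix of a two-colouring, which conjugates the Laplacian into the signless
Laplacian. -/
def signMatrix (c : G.Coloring Bool) : Matrix V V ℝ := diagonal fun i => if c i then 1 else -1

theorem signMatrix_mul_self (c : G.Coloring Bool) : signMatrix c * signMatrix c = 1 := by
  rw [signMatrix, diagonal_mul_diagonal, diagonal_eq_one]
  ext i
  cases c i <;> simp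

variable [DecidableRel G.Adj]

theorem signlessLapMatrix_eq_signMatrix_mul (c : G.Coloring Bool) :
    G.signlessLapMatrix = signMatrix c * G.lapMatrix ℝ * signMatrix c := by
  ext i j
  rw [signMatrix, mul_diagonal, diagonal_mul]
  obtain rfl | hij := eq_or_ne i j
  · cases c i <;> simp [signlessLapMatrix, lapMatrix]
  · by_cases h : G.Adj i j
    · have hc := c.valid h
      revert hc
      cases c i <;> cases c j <;> simp [signlessLapMatrix, lapMatrix, degMatrix, hij, h]
    · simp [signlessLapMatrix, lapMatrix, degMatrix, hij, h]

theorem posSemidef_signlessLapMatrix (c : G.Coloring Bool) : G.signlessLapMatrix.PosSemidef := by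
  have h := (posSemidef_lapMatrix ℝ G).mul_mul_conjTranspose_same (signMatrix c)
  rwa [show (signMatrix c)ᴴ = signMatrix c by simp [signMatrix],
    ← signlessLapMatrix_eq_signMatrix_mul] at h

theorem det_one_add_smul_signlessLapMatrix (c : G.Coloring Bool) (x : ℝ) :
    (1 + x • G.signlessLapMatrix).det = lapDet G x := by
  have h : 1 + x • G.signlessLapMatrix = signMatrix c * shiftedLap G x * signMatrix c := by
    rw [signlessLapMatrix_eq_signMatrix_mul c, shiftedLap, Matrix.mul_add, Matrix.add_mul,
      Matrix.mul_one, signMatrix_mul_self, Matrix.mul_smul, Matrix.smul_mul]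
  rw [h, det_mul, det_mul, mul_right_comm, ← det_mul, signMatrix_mul_self, det_one, one_mul,
    lapDet]

end SignMatrix

variable {W : Type*} [Fintype W] {H : SimpleGraph W}

open Classical in
theorem integral_log_lapDet_inv_sq (c : G.Coloring Bool) :
    ∫ s in Ioi (0 : ℝ), Real.log (lapDet G (s ^ 2)⁻¹) = Real.pi * G.incidenceEnergy := by
  simp only [← det_one_add_smul_signlessLapMatrix c]
  exact integral_log_det_one_add_inv_sq_smul (posSemidef_signlessLapMatrix c)

open Classical in
theorem integrableOn_log_lapDet_inv_sq (c : G.Coloring Bool) :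
    IntegrableOn (fun s : ℝ => Real.log (lapDet G (s ^ 2)⁻¹)) (Ioi 0) := by
  simp only [← det_one_add_smul_signlessLapMatrix c]
  exact integrableOn_log_det_one_add_inv_sq_smul (posSemidef_signlessLapMatrix c)

open Classical in
theorem incidenceEnergy_lt_of_lapDet_lt (c : G.Coloring Bool) (d : H.Coloring Bool)
    (h : ∀ x, 0 < x → lapDet G x < lapDet H x) : G.incidenceEnergy < H.incidenceEnergy := by
  refine lt_of_mul_lt_mul_left ?_ Real.pi_pos.le
  rw [← integral_log_lapDet_inv_sq c, ← integral_log_lapDet_inv_sq d]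
  refine setIntegral_lt_setIntegral_of_forall_lt measurableSet_Ioi (by simp)
    (integrableOn_log_lapDet_inv_sq c) (integrableOn_log_lapDet_inv_sq d) fun s hs => ?_
  have hx : 0 < (s ^ 2)⁻¹ := inv_pos.2 (pow_pos hs 2)
  exact Real.log_lt_log (lapDet_pos G hx.le) (h _ hx)

open Classical in
theorem incidenceEnergy_eq_of_iso (f : G ≃g H) : G.incidenceEnergy = H.incidenceEnergy := by
  have hsub : H.signlessLapMatrix.submatrix f f = G.signlessLapMatrix := by
    ext i j
    simp [signlessLapMatrix, degMatrix, diagonal_apply, adjMatrix_apply, f.degree_eq,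
      f.injective.eq_iff, f.map_adj_iff]
  have hroots : G.signlessLapMatrix.charpoly.roots = H.signlessLapMatrix.charpoly.roots := by
    rw [← hsub, ← charpoly_reindex f.toEquiv.symm H.signlessLapMatrix]
    rfl
  rw [G.isHermitian_signlessLapMatrix.roots_charpoly_eq_eigenvalues,
    H.isHermitian_signlessLapMatrix.roots_charpoly_eq_eigenvalues] at hroots
  have hsum := congrArg (fun m : Multiset ℝ => (m.map Real.sqrt).sum) hroots
  simp only [Multiset.map_map] at hsum
  exact hsum

open Classical in
theorem sum_degrees_of_isUnicyclic (hG : G.IsUnicyclic) :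
    ∑ v, G.degree v = 2 * Fintype.card V := by
  rw [sum_degrees_eq_twice_card_edges, ← hG.2, ← coe_edgeFinset, Set.ncard_coe_finset]

theorem incidenceEnergy_starC4_lt_or_nonempty_iso {n : ℕ} (hcard : Fintype.card V = n)
    (hG : G.IsUnicyclic) (c : G.Coloring Bool) :
    (starC4 n).incidenceEnergy < G.incidenceEnergy ∨ Nonempty (G ≃g starC4 n) := by
  classical
  have hfree : G.CliqueFree 3 := c.colorable.cliqueFree (by simp)
  have hsum : ∑ v, G.degree v = 2 * n := hcard ▸ sum_degrees_of_isUnicyclic hG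
  by_cases hcenter : ∃ v, G.degree v + 2 = n
  · obtain ⟨v, hv⟩ := hcenter
    obtain ⟨f, -⟩ := exists_iso_starC4 hcard (isIndepSet_neighborSet_of_triangleFree G hfree v)
      hsum hv
    exact .inr ⟨f.symm⟩
  · refine .inl (incidenceEnergy_lt_of_lapDet_lt (starC4Coloring n) c fun x hx => ?_)
    have h := (StarC4LapBounds.of_cliqueFree_three hx hcard hG.1 hsum hfree).det_lt
      (not_exists.1 hcenter)
    convert h

end Energy

theorem corollary5p4 (n : ℕ) (hn : 4 ≤ n) :
    (Fintype.card (Fin 4 ⊕ Fin (n - 4)) = n ∧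
      (SimpleGraph.starC4 n).IsUnicyclic ∧ Even (SimpleGraph.starC4 n).girth) ∧
    ∀ {V : Type*} [Fintype V] (G : SimpleGraph V),
      Fintype.card V = n → G.IsUnicyclic → Even G.girth →
        (SimpleGraph.starC4 n).incidenceEnergy ≤ G.incidenceEnergy ∧
        (G.incidenceEnergy = (SimpleGraph.starC4 n).incidenceEnergy ↔
          Nonempty (G ≃g SimpleGraph.starC4 n)) := by
  refine ⟨⟨by simp [hn], starC4_isUnicyclic n, even_girth_of_coloring_bool (starC4Coloring n)⟩,
    fun G hcard hG heven => ?_⟩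
  obtain ⟨c⟩ := nonempty_coloring_bool_of_even_girth hG heven
  obtain hlt | ⟨⟨f⟩⟩ := incidenceEnergy_starC4_lt_or_nonempty_iso hcard hG c
  · exact ⟨hlt.le, fun h => absurd h hlt.ne', fun ⟨f⟩ => incidenceEnergy_eq_of_iso f⟩
  · have heq := incidenceEnergy_eq_of_iso f
    exact ⟨heq.ge, fun _ => ⟨f⟩, fun _ => heq⟩
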